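/- Fix $n\ge 2$, a pool $x_1,\dots,x_n$ in a set $\mathcal X$, and a finite score set $\mathcal Y\subset\mathbb R$ with $|\mathcal Y|\ge 2$. In noiseless best-arm identification with unknown scores $y=(y_1,\dots,y_n)\in\mathcal Y^n$, an algorithm adaptively (and possibly at random) queries arms $i\in[n]$, each time observing $y_i$, and finally stops and outputs an arm; the goal is to output an element of $\operatorname{argmin}_{i\in[n]}y_i$. For a class $\mathcal F\subset\mathcal Y^{\mathcal X}$, an algorithm is $(\delta,k)$-agnostic with respect to $\mathcal F$ if, for every $y\in\mathcal Y^n$ with $\min_{f\in\mathcal F}\sum_{i=1}^n\mathbf 1\{f(x_i)\ne y_i\}\le k$, it stops and outputs an element of $\operatorname{argmin}_{i\in[n]}y_i$ with probability at least $1-\delta$. **Proposition.** There are universal constants $c>0$ and $C\in\mathbb N$ such that the following holds for all $n$, $x_1,\dots,x_n$ and $\mathcal Y$ as above and all $\delta\in(0,\min(\tfrac1{40},\tfrac1n))$. There is a class $\mathcal F=\{f^*\}\subset\mathcal Y^{\mathcal X}$ consisting of a single function such that 1. for every algorithm $\mathcal A$ that is $(\delta,1)$-agnostic with respect to $\mathcal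 F$, there is $f\in\mathcal F$ such that on the scores $y_i=f(x_i)$ the expected number of queries of $\mathcal A$ is at least $c\,\dfrac{n}{\log(n/\delta)}$; 2. there is a (deterministic) algorithm that, for every $f\in\mathcal F$, on the scores $y_i=f(x_i)$ outputs an element of $\operatorname{argmin}_{i\in[n]}f(x_i)$ after at most $C$ queries. -/

import Mathlib

open MeasureTheory
open scoped ENNReal

namespace BestArm

/-- What a learner does next: query one of the `n` arms, or stop and output an arm. -/
inductive Move (n : ℕ) where
  | query (i : Fin n) : Move n
  | output (i : Fin n) : Move n

/-- A deterministic adaptive algorithm with score set `Y`: the next move as a function of the past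
queries and their (noiseless) answers, listed in order. -/
abbrev Strategy (n : ℕ) (Y : Type*) := List (Fin n × Y) → Move n

/-- The list of queries and answers after `t` moves of `σ` when the scores of the arms are `y`.
It no longer changes once `σ` has stopped. -/
def Strategy.history {n : ℕ} {Y : Type*} (σ : Strategy n Y) (y : Fin n → Y) :
    ℕ → List (Fin n × Y)
  | 0 => []
  | t + 1 =>
    match σ (Strategy.history σ y t) with
    | Move.query i => Strategy.history σ y t ++ [(i, y i)]
    | Move.output _ => Strategy.history σ y t

/-- On scores `y`, the algorithm `σ` stops after finitely many queries and outputs arm `j`. -/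
def Strategy.Outputs {n : ℕ} {Y : Type*} (σ : Strategy n Y) (y : Fin n → Y) (j : Fin n) : Prop :=
  ∃ t : ℕ, σ (σ.history y t) = Move.output j

/-- The total number of queries (counted with repetition) that `σ` makes on scores `y`; it is `⊤`
if `σ` never stops. -/
noncomputable def Strategy.numQueries {n : ℕ} {Y : Type*} (σ : Strategy n Y) (y : Fin n → Y) :
    ℕ∞ :=
  ⨆ t : ℕ, ((σ.history y t).length : ℕ∞)

/-- `σ` finds a best arm on scores `y`: it outputs an element of `argmin_i y_i`. -/
def Strategy.FindsBest {n : ℕ} {Y : Type*} [LE Y] (σ : Strategy n Y) (y : Fin n → Y) : Prop :=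
  ∃ j : Fin n, σ.Outputs y j ∧ ∀ i : Fin n, y j ≤ y i

/-- A randomized adaptive algorithm: a deterministic one for each value of its internal random
seed `ω`, where each move depends measurably on the seed. -/
structure RandomizedAlgorithm (n : ℕ) (Y Ω : Type*) [MeasurableSpace Ω] where
  strategy : Ω → Strategy n Y
  measurable_move : ∀ (h : List (Fin n × Y)) (m : Move n), MeasurableSet {ω | strategy ω h = m}

/-- The expected number of queries on scores `y` when the seed has law `P`. -/
noncomputable def RandomizedAlgorithm.expectedQueries {n : ℕ} {Y Ω : Type*} [MeasurableSpace Ω]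
    (A : RandomizedAlgorithm n Y Ω) (P : Measure Ω) (y : Fin n → Y) : ℝ≥0∞ :=
  ∫⁻ ω, ((A.strategy ω).numQueries y : ℝ≥0∞) ∂P

/-- `(δ, k)`-agnostic algorithms with respect to the class `F` and the pool `x₁, …, xₙ`: for all
scores `y ∈ Yⁿ` that differ from some `f ∈ F` on at most `k` arms, the algorithm outputs an element
of `argmin_i y_i` with probability at least `1 - δ`. -/
def RandomizedAlgorithm.IsAgnostic {n : ℕ} {X Y Ω : Type*} [LE Y] [MeasurableSpace Ω]
    (A : RandomizedAlgorithm n Y Ω) (P : Measure Ω) (F : Set (X → Y)) (x : Fin n → X)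
    (δ : ℝ) (k : ℕ) : Prop :=
  ∀ y : Fin n → Y, (∃ f ∈ F, {i : Fin n | f (x i) ≠ y i}.ncard ≤ k) →
    ENNReal.ofReal (1 - δ) ≤ P {ω | (A.strategy ω).FindsBest y}

/-- `σ` solves every realizable instance of the class `F` with at most `q` queries: whenever the
scores are `y_i = f (x_i)` for some `f ∈ F`, it outputs an element of `argmin_i f (x_i)` after at
most `q` queries. -/
def Strategy.SolvesRealizable {n : ℕ} {X Y : Type*} [LE Y] (σ : Strategy n Y) (F : Set (X → Y))
    (x : Fin n → X) (q : ℕ) : Prop :=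
  ∀ f ∈ F, σ.FindsBest (fun i => f (x i)) ∧ σ.numQueries (fun i => f (x i)) ≤ (q : ℕ∞)

end BestArm

namespace BestArm

namespace Strategy

variable {n : ℕ} {Y : Type*} (σ : Strategy n Y)

/-! Take `fstar` constant, equal to a score `b` that is not the least one. Every arm is then
optimal, so no query is needed. Lowering one arm `i` to some `a < b` is a single corruption, after
which `i` is the only right answer. For a fixed seed, this run coincides with the constant run
unless the latter queries `i`. So all arms `i` recognised in this way, except possibly the one
output on constant scores, are queried there (`ncard_findsBest_update_le`). Averaging over the seed
gives `n * (1 - δ) ≤ E + 1`, with `E` the expected number of queries: a linear bound, stronger than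
the one required. -/

theorem history_succ_of_query {y : Fin n → Y} {t : ℕ} {i : Fin n}
    (h : σ (σ.history y t) = Move.query i) :
    σ.history y (t + 1) = σ.history y t ++ [(i, y i)] := by
  rw [history, h]

theorem history_succ_of_output {y : Fin n → Y} {t : ℕ} {j : Fin n}
    (h : σ (σ.history y t) = Move.output j) : σ.history y (t + 1) = σ.history y t := by
  rw [history, h]

theorem history_add_of_output {y : Fin n → Y} {t : ℕ} {j : Fin n}
    (h : σ (σ.history y t) = Move.output j) (s : ℕ) :
    σ.history y (t + s) = σ.history y t := by
  induction s with
  | zero => rfl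
  | succ s ih =>
    rw [← ih] at h
    rw [← add_assoc, σ.history_succ_of_output h, ih]

theorem output_unique {y : Fin n → Y} {i j : Fin n} (hi : σ.Outputs y i) (hj : σ.Outputs y j) :
    i = j := by
  obtain ⟨s, hs⟩ := hi
  obtain ⟨t, ht⟩ := hj
  rcases le_total s t with h | h
  · obtain ⟨d, rfl⟩ := Nat.exists_eq_add_of_le h
    rw [σ.history_add_of_output hs, hs] at ht
    exact Move.output.inj ht
  · obtain ⟨d, rfl⟩ := Nat.exists_eq_add_of_le h
    rw [σ.history_add_of_output ht, ht] at hs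
    exact (Move.output.inj hs).symm

/-- A run only depends on the scores of the arms that it queries. -/
theorem history_congr {y z : Fin n → Y} (t : ℕ)
    (h : ∀ p ∈ σ.history y t, y p.1 = z p.1) : σ.history z t = σ.history y t := by
  induction t with
  | zero => rfl
  | succ t ih =>
    cases hm : σ (σ.history y t) with
    | query i =>
      rw [σ.history_succ_of_query hm] at h ⊢
      have e := ih fun p hp => h p (List.mem_append_left _ hp)
      have hi : y i = z i := h (i, y i) (by simp)
      rw [← e] at hm
      rw [σ.history_succ_of_query hm, e, hi]
    | output j =>
      rw [σ.history_succ_of_output hm] at h ⊢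
      have e := ih h
      rw [← e] at hm
      rw [σ.history_succ_of_output hm, e]

theorem length_history_of_not_outputs {y : Fin n → Y} (h : ∀ j, ¬ σ.Outputs y j) (t : ℕ) :
    (σ.history y t).length = t := by
  induction t with
  | zero => rfl
  | succ t ih =>
    cases hm : σ (σ.history y t) with
    | query i => rw [σ.history_succ_of_query hm]; simp [ih]
    | output j => exact absurd ⟨t, hm⟩ (h j)

theorem numQueries_eq_top {y : Fin n → Y} (h : ∀ j, ¬ σ.Outputs y j) : σ.numQueries y = ⊤ := by
  rw [numQueries, ENat.eq_top_iff_forall_ge]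
  intro m
  refine le_iSup_of_le m ?_
  rw [σ.length_history_of_not_outputs h]

/-- Lowering the score of a single arm below an otherwise constant vector of scores makes it the
only best arm. -/
theorem outputs_of_findsBest_update [Preorder Y] {a b : Y} (hab : a < b) {i : Fin n}
    (h : σ.FindsBest (Function.update (fun _ => b) i a)) :
    σ.Outputs (Function.update (fun _ => b) i a) i := by
  obtain ⟨j, hj, hmin⟩ := h
  have hji : j = i := by
    by_contra hne
    have := hmin i
    rw [Function.update_self, Function.update_of_ne hne] at this
    exact this.not_gt hab
  rwa [hji] at hj

/-- The arms that `σ` would recognise if they were the only best arm must all be queried on the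
constant scores, except for the one that is output there. -/
theorem ncard_findsBest_update_le [Preorder Y] {a b : Y} (hab : a < b) :
    (({i : Fin n | σ.FindsBest (Function.update (fun _ => b) i a)}.ncard : ℕ) : ℕ∞) ≤
      σ.numQueries (fun _ => b) + 1 := by
  classical
  by_cases hout : ∃ j, σ.Outputs (fun _ => b) j
  · obtain ⟨j, t, ht⟩ := hout
    set l := σ.history (fun _ => b) t with hl
    have hsub : {i : Fin n | σ.FindsBest (Function.update (fun _ => b) i a)} ⊆
        (insert j (l.map Prod.fst).toFinset : Finset (Fin n)) := by
      intro i hi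
      by_contra hmem
      simp only [Finset.coe_insert, Set.mem_insert_iff, Finset.mem_coe, List.mem_toFinset,
        List.mem_map, not_or, not_exists, not_and] at hmem
      -- Arm `i` is never queried in the constant run, so lowering it goes unnoticed and the output
      -- is still `j ≠ i`.
      have e : σ.history (Function.update (fun _ => b) i a) t = l := by
        refine σ.history_congr t fun p hp => ?_
        rw [Function.update_of_ne (hmem.2 p hp)]
      have hj : σ.Outputs (Function.update (fun _ => b) i a) j := ⟨t, by rw [e, ht]⟩
      exact hmem.1 (σ.output_unique (σ.outputs_of_findsBest_update hab hi) hj)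
    have hcard : {i : Fin n | σ.FindsBest (Function.update (fun _ => b) i a)}.ncard ≤
        l.length + 1 :=
      calc _ ≤ (insert j (l.map Prod.fst).toFinset : Finset (Fin n)).card := by
            rw [← Set.ncard_coe_finset]
            exact Set.ncard_le_ncard hsub (Finset.finite_toSet _)
        _ ≤ (l.map Prod.fst).toFinset.card + 1 := Finset.card_insert_le _ _
        _ ≤ l.length + 1 := by
            simpa using List.toFinset_card_le (l.map Prod.fst)
    calc _ ≤ ((l.length + 1 : ℕ) : ℕ∞) := by exact_mod_cast hcard
      _ ≤ _ := by
        push_cast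
        gcongr
        exact le_iSup (fun t => ((σ.history (fun _ => b) t).length : ℕ∞)) t
  -- A run that never stops queries forever, so the bound is trivial.
  · rw [σ.numQueries_eq_top (not_exists.mp hout)]
    simp

end Strategy

namespace RandomizedAlgorithm

variable {n : ℕ} {Y Ω : Type*} [MeasurableSpace Ω] (A : RandomizedAlgorithm n Y Ω)

/-- With `Y` countable there are only countably many histories, so the event splits along them. -/
theorem measurableSet_move_history [Countable Y] (y : Fin n → Y) (t : ℕ)
    (hist : ∀ l, MeasurableSet {ω | (A.strategy ω).history y t = l}) (m : Move n) :
    MeasurableSet {ω | A.strategy ω ((A.strategy ω).history y t) = m} := by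
  have : {ω | A.strategy ω ((A.strategy ω).history y t) = m} =
      ⋃ l, {ω | (A.strategy ω).history y t = l} ∩ {ω | A.strategy ω l = m} := by
    ext ω
    simp
  rw [this]
  exact .iUnion fun l => (hist l).inter (A.measurable_move l m)

theorem measurableSet_history [Countable Y] (y : Fin n → Y) (t : ℕ) (l : List (Fin n × Y)) :
    MeasurableSet {ω | (A.strategy ω).history y t = l} := by
  induction t generalizing l with
  | zero => exact .const ([] = l)
  | succ t ih =>
    have hmove := A.measurableSet_move_history y t ih
    have : {ω | (A.strategy ω).history y (t + 1) = l} =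
        (⋃ i, ⋃ l', {ω | A.strategy ω ((A.strategy ω).history y t) = Move.query i} ∩
          ({ω | (A.strategy ω).history y t = l'} ∩ {_ω | l' ++ [(i, y i)] = l})) ∪
        ⋃ j, {ω | A.strategy ω ((A.strategy ω).history y t) = Move.output j} ∩
          {ω | (A.strategy ω).history y t = l} := by
      ext ω
      cases hm : A.strategy ω ((A.strategy ω).history y t) with
      | query i => simp [Strategy.history_succ_of_query _ hm, hm]
      | output j => simp [Strategy.history_succ_of_output _ hm, hm]
    rw [this]
    refine .union (.iUnion fun i => .iUnion fun l' => ?_) (.iUnion fun j => ?_)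
    · exact (hmove _).inter ((ih l').inter (.const _))
    · exact (hmove _).inter (ih l)

theorem measurableSet_findsBest [Countable Y] [LE Y] (y : Fin n → Y) :
    MeasurableSet {ω | (A.strategy ω).FindsBest y} := by
  have : {ω | (A.strategy ω).FindsBest y} =
      ⋃ j, (⋃ t, {ω | A.strategy ω ((A.strategy ω).history y t) = Move.output j}) ∩
        {_ω | ∀ i, y j ≤ y i} := by
    ext ω
    simp [Strategy.FindsBest, Strategy.Outputs]
  rw [this]
  exact .iUnion fun j => (MeasurableSet.iUnion fun t =>
    A.measurableSet_move_history y t (A.measurableSet_history y t) _).inter (.const _)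

/-- An algorithm that recognises each single best arm with probability at least `p` makes at least
`n p - 1` queries in expectation on constant scores. -/
theorem mul_le_expectedQueries_add_one [Countable Y] [Preorder Y] (P : Measure Ω)
    [IsProbabilityMeasure P] {a b : Y} (hab : a < b) {p : ℝ≥0∞}
    (h : ∀ i, p ≤ P {ω | (A.strategy ω).FindsBest (Function.update (fun _ => b) i a)}) :
    n * p ≤ A.expectedQueries P (fun _ => b) + 1 := by
  classical
  let S : Fin n → Set Ω := fun i =>
    {ω | (A.strategy ω).FindsBest (Function.update (fun _ => b) i a)}
  have hS : ∀ i, MeasurableSet (S i) := fun i => A.measurableSet_findsBest _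
  calc (n : ℝ≥0∞) * p = ∑ _i : Fin n, p := by simp
    _ ≤ ∑ i, P (S i) := Finset.sum_le_sum fun i _ => h i
    _ = ∑ i, ∫⁻ ω, (S i).indicator 1 ω ∂P := by
      simp_rw [lintegral_indicator_one (hS _)]
    -- The sum now counts, for each seed, the recognised arms.
    _ = ∫⁻ ω, ∑ i, (S i).indicator 1 ω ∂P :=
      (lintegral_finsetSum _ fun i _ => measurable_one.indicator (hS i)).symm
    _ ≤ ∫⁻ ω, (((A.strategy ω).numQueries (fun _ => b) : ℝ≥0∞) + 1) ∂P := by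
      refine lintegral_mono fun ω => ?_
      have hsum : ∑ i, (S i).indicator (1 : Ω → ℝ≥0∞) ω =
          ({i | (A.strategy ω).FindsBest (Function.update (fun _ => b) i a)}.ncard : ℝ≥0∞) := by
        rw [Set.ncard_eq_toFinset_card']
        simp [S, Set.indicator_apply]
      have := (A.strategy ω).ncard_findsBest_update_le hab
      rw [hsum]
      simpa only [ENat.toENNReal_add, ENat.toENNReal_one, ENat.toENNReal_coe] using
        ENat.toENNReal_le.mpr this
    _ = A.expectedQueries P (fun _ => b) + 1 := by
      rw [lintegral_add_right _ measurable_const]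
      simp [expectedQueries]

end RandomizedAlgorithm

theorem Strategy.const_output_solvesRealizable {n : ℕ} {X Y : Type*} [Preorder Y] (b : Y)
    (x : Fin n → X) (j : Fin n) :
    Strategy.SolvesRealizable (fun _ => Move.output j) {fun _ => b} x 0 := by
  intro f hf
  rw [Set.mem_singleton_iff] at hf
  subst hf
  refine ⟨⟨j, ⟨0, rfl⟩, fun _ => le_rfl⟩, iSup_le fun t => ?_⟩
  have := Strategy.history_add_of_output (fun _ => Move.output j) (y := fun _ => b) (t := 0) rfl t
  rw [zero_add] at this
  rw [this]
  rfl

/-- Since `n / δ > 3 > e`, the logarithm is at least 1, and `n / 4 + 1 ≤ 3 * n / 4` because `n ≥ 2`.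
-/
theorem quarter_mul_div_log_add_one_le {n : ℕ} (hn : 2 ≤ n) {δ : ℝ} (hδ : 0 < δ)
    (hδ' : δ < 1 / 40) : 1 / 4 * (n / Real.log (n / δ)) + 1 ≤ n * (1 - δ) := by
  have hn' : (2 : ℝ) ≤ n := by exact_mod_cast hn
  have hlog : 1 ≤ Real.log (n / δ) := by
    rw [Real.le_log_iff_exp_le (by positivity)]
    refine Real.exp_one_lt_three.le.trans ?_
    rw [le_div_iff₀ hδ]
    linarith
  have : n / Real.log (n / δ) ≤ n := div_le_self (by positivity) hlog
  nlinarith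

end BestArm

theorem proposition3 :
    ∃ c : ℝ, 0 < c ∧ ∃ C : ℕ,
      ∀ (n : ℕ), 2 ≤ n → ∀ (δ : ℝ), 0 < δ → δ < min (1 / 40) (1 / (n : ℝ)) →
      ∀ (Y : Finset ℝ), 2 ≤ Y.card → ∀ (X : Type*) (x : Fin n → X),
        ∃ F : Set (X → Y), (∃ fstar : X → Y, F = {fstar}) ∧
          (∀ (Ω : Type*) [MeasurableSpace Ω] (P : Measure Ω) [IsProbabilityMeasure P]
            (A : BestArm.RandomizedAlgorithm n Y Ω), A.IsAgnostic P F x δ 1 →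
            ∃ f ∈ F, ENNReal.ofReal (c * (n / Real.log (n / δ))) ≤
              A.expectedQueries P (fun i => f (x i))) ∧
          ∃ σ : BestArm.Strategy n Y, σ.SolvesRealizable F x C := by
  refine ⟨1 / 4, by norm_num, 0, fun n hn δ hδ hδ' Y hY X x => ?_⟩
  obtain ⟨a, b, hab⟩ : ∃ a b : Y, a < b := by
    have : Nontrivial Y := Finset.one_lt_card_iff_nontrivial.mp hY |>.coe_sort
    obtain ⟨a, b, hne⟩ := exists_pair_ne Y
    exact hne.lt_or_gt.elim (fun h => ⟨a, b, h⟩) fun h => ⟨b, a, h⟩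
  refine ⟨{fun _ => b}, ⟨_, rfl⟩, ?_, _,
    BestArm.Strategy.const_output_solvesRealizable b x ⟨0, by omega⟩⟩
  intro Ω _ P _ A hA
  refine ⟨_, rfl, ?_⟩
  have key := A.mul_le_expectedQueries_add_one P hab (p := ENNReal.ofReal (1 - δ)) fun i => by
    refine hA _ ⟨_, rfl, (Set.ncard_le_ncard (t := {i}) ?_).trans (Set.ncard_singleton i).le⟩
    intro j hj
    by_contra hne
    exact hj (Function.update_of_ne hne a fun _ => b).symm
  -- Adding 1 to both sides avoids truncated subtraction.
  rw [← ENNReal.add_le_add_iff_right ENNReal.one_ne_top]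
  refine le_trans ?_ key
  have hlog : 0 ≤ Real.log (n / δ) :=
    Real.log_nonneg ((one_le_div hδ).mpr (by
      have : (2 : ℝ) ≤ n := by exact_mod_cast hn
      linarith [hδ'.trans_le (min_le_left _ _)]))
  rw [← ENNReal.ofReal_natCast, ← ENNReal.ofReal_mul (by positivity), ← ENNReal.ofReal_one,
    ← ENNReal.ofReal_add (by positivity) zero_le_one]
  exact ENNReal.ofReal_le_ofReal
    (BestArm.quarter_mul_div_log_add_one_le hn hδ (hδ'.trans_le (min_le_left _ _)))
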